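/- Let $k, n, r$ be positive integers with $4 \le k \le r$. A Berge path of length $k$ is a hypergraph consisting of distinct vertices $v_0, v_1, \dots, v_k$ and distinct hyperedges $e_1, \dots, e_k$ such that $v_{i-1}, v_i \in e_i$ for $i = 1, \dots, k$ (together with the remaining vertices of these hyperedges); let $\mathcal{BP}_k$ be the family of all Berge paths of length $k$. Let $\mathrm{ex}_r(n, \mathcal{BP}_k)$ be the maximum number of hyperedges in an $n$-vertex $r$-uniform hypergraph without multiple hyperedges that contains no member of $\mathcal{BP}_k$ as a sub-hypergraph. Then $$\mathrm{ex}_r(n, \mathcal{BP}_k) = \left\lfloor \frac{n}{r+1} \right\rfloor (k-1) + \mathbb{1}_{(r+1)\mathbb{N}^*}(n+1),$$ where $\mathbb{1}_{(r+1)\mathbb{N}^*}(m)$ equals $1$ if $m$ is a positive multiple of $r+1$ and $0$ otherwise. -/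

import Mathlib

namespace Hypergraph

/-- `H` is an `r`-graph: every hyperedge has exactly `r` vertices. There are no multiple hyperedges,
since the hyperedges of a `Hypergraph` form a set. -/
def IsUniform {α : Type*} (H : Hypergraph α) (r : ℕ) : Prop :=
  ∀ e ∈ H.edgeSet, e.encard = r

/-- `H` contains a copy of `B` as a sub-hypergraph: some map, injective on the vertices of `B`,
sends vertices of `B` to vertices of `H` and hyperedges of `B` to hyperedges of `H`. -/
def ContainsCopy {α β : Type*} (H : Hypergraph α) (B : Hypergraph β) : Prop :=
  ∃ f : β → α, Set.InjOn f B.vertexSet ∧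
    (B.image f).vertexSet ⊆ H.vertexSet ∧ (B.image f).edgeSet ⊆ H.edgeSet

/-- `H` is `𝓕`-free: it contains no copy of any member of the family `𝓕`. The members of a family
are taken with vertices in `ℕ`; up to isomorphism every finite hypergraph is of this form. -/
def IsFree {α : Type*} (H : Hypergraph α) (𝓕 : Set (Hypergraph ℕ)) : Prop :=
  ∀ B ∈ 𝓕, ¬ H.ContainsCopy B

/-- `B` is a Berge path of length `t`: it consists of distinct vertices `v 0, …, v t` and distinct
hyperedges `e 0, …, e (t - 1)` such that `v i` and `v (i + 1)` both lie in `e i`, together with the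
remaining vertices of these hyperedges. -/
def IsBergePath {α : Type*} (B : Hypergraph α) (t : ℕ) : Prop :=
  ∃ (v : Fin (t + 1) → α) (e : Fin t → Set α),
    Function.Injective v ∧ Function.Injective e ∧
    (∀ i : Fin t, v i.castSucc ∈ e i ∧ v i.succ ∈ e i) ∧
    B.edgeSet = Set.range e ∧ B.vertexSet = Set.range v ∪ ⋃ i, e i

/-- The family of Berge paths of length `k`. -/
def bergePaths (k : ℕ) : Set (Hypergraph ℕ) :=
  {B | B.IsBergePath k}

/-- The numbers of hyperedges of the `𝓕`-free `r`-graphs on the vertex set `Fin n`. -/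
def freeEdgeCounts (r n : ℕ) (𝓕 : Set (Hypergraph ℕ)) : Set ℕ :=
  {m | ∃ H : Hypergraph (Fin n), H.vertexSet = Set.univ ∧ H.IsUniform r ∧ H.IsFree 𝓕 ∧
    H.edgeSet.ncard = m}

/-- The Turán number `ex_r(n, 𝓕)`: the maximum number of hyperedges in an `𝓕`-free `r`-graph on `n`
vertices. -/
noncomputable def turanNumber (r n : ℕ) (𝓕 : Set (Hypergraph ℕ)) : ℕ :=
  sSup (freeEdgeCounts r n 𝓕)

theorem bddAbove_freeEdgeCounts (r n : ℕ) (𝓕 : Set (Hypergraph ℕ)) :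
    BddAbove (freeEdgeCounts r n 𝓕) := by
  refine ⟨Nat.card (Set (Fin n)), ?_⟩
  rintro m ⟨H, -, -, -, rfl⟩
  exact Set.ncard_le_card _

/-- For a positive length the supremum in the Turán number of Berge paths is a maximum. -/
theorem isGreatest_turanNumber_bergePaths (r n k : ℕ) (hk : 0 < k) :
    IsGreatest (freeEdgeCounts r n (bergePaths k)) (turanNumber r n (bergePaths k)) := by
  refine ⟨Nat.sSup_mem ⟨0, trivialOn Set.univ, rfl, ?_, ?_, ?_⟩ (bddAbove_freeEdgeCounts r n _),
    fun m hm => le_csSup (bddAbove_freeEdgeCounts r n _) hm⟩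
  · intro e he
    simp at he
  · rintro B ⟨v, e, -, -, -, hE, -⟩ ⟨f, -, -, h⟩
    have h0 : e ⟨0, hk⟩ ∈ B.edgeSet := hE ▸ Set.mem_range_self _
    exact h (image_mem_edgeSet_image h0)
  · simp

end Hypergraph

/-- The characteristic function of `r ℕ*`, the set of positive multiples of `r`. -/
noncomputable def posMultiplesIndicator (r : ℕ) : ℕ → ℕ :=
  Set.indicator {n : ℕ | ∃ j : ℕ, 0 < j ∧ n = r * j} 1

/-! A Berge path is reduced to its edges and inner connectors. Since `k ≤ r`, an edge path with `k`
edges always has two distinct spare end vertices (`exists_bergePath_of_isEdgePath`), so a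
`BP_k`-free hypergraph has no such edge path.

Upper bound, by induction on the number of vertices: take a longest edge path, with `m + 1 ≤ k - 1`
edges forming `F`. A vertex at which some edge path through all of `F` can end lies on no edge
outside `F`, since that edge would prolong the path (`IsFreeEnd.mem_of_mem`). Pósa-style rotations
give at least `r + 1` such vertices when `m > 0` (`exists_card_isFreeEnd`), so deleting `r + 1` of
them costs at most `k - 1` edges. When `m = 0`, deleting the `r` vertices of an isolated edge costs
one edge. The claimed bound absorbs both losses.

Lower bound: a Berge path is connected, so in disjoint blocks of `r + 1` vertices with `k - 1` edges
each it never finds `k` edges; `r` leftover vertices carry one more edge. -/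

/-! ### Edge paths, their rotations and cyclic shifts. -/

section EdgePath

variable {α : Type*}

/-- An edge path in `F`: distinct members `e 0, …, e m` of `F` in which consecutive ones are joined
by distinct connectors `v i ∈ e i ∩ e (i + 1)`. -/
structure IsEdgePath (F : Finset (Finset α)) (m : ℕ) (e : ℕ → Finset α) (v : ℕ → α) : Prop where
  mem_edges : ∀ i ≤ m, e i ∈ F
  edge_inj : ∀ i ≤ m, ∀ j ≤ m, e i = e j → i = j
  vertex_inj : ∀ i < m, ∀ j < m, v i = v j → i = j
  mem_left : ∀ i < m, v i ∈ e i
  mem_right : ∀ i < m, v i ∈ e (i + 1)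

/-- The vertex `w` can be the free endpoint of an edge path with `m + 1` edges of `F`. -/
def IsFreeEnd (F : Finset (Finset α)) (m : ℕ) (w : α) : Prop :=
  ∃ e v, IsEdgePath F m e v ∧ w ∈ e 0 ∧ ∀ i < m, v i ≠ w

/-- The edges after reversing the segment `e 0, …, e p`. -/
def rotEdge (e : ℕ → Finset α) (p j : ℕ) : Finset α := if j ≤ p then e (p - j) else e j

/-- The connectors after reversing the segment `e 0, …, e p` and joining `e 0` to `e (p + 1)`
by `x`. -/
def rotVertex (v : ℕ → α) (p : ℕ) (x : α) (j : ℕ) : α :=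
  if j < p then v (p - 1 - j) else if j = p then x else v j

namespace IsEdgePath

variable {F : Finset (Finset α)} {m p : ℕ} {e : ℕ → Finset α} {v : ℕ → α} {x : α}

theorem mono {G : Finset (Finset α)} (h : IsEdgePath F m e v) (hFG : F ⊆ G) :
    IsEdgePath G m e v :=
  ⟨fun i hi => hFG (h.mem_edges i hi), h.edge_inj, h.vertex_inj, h.mem_left, h.mem_right⟩

theorem reverse (h : IsEdgePath F m e v) :
    IsEdgePath F m (fun j => e (m - j)) (fun j => v (m - 1 - j)) := by
  refine ⟨fun i hi => h.mem_edges _ (by omega), fun i hi j hj hij => ?_, fun i hi j hj hij => ?_,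
    fun i hi => ?_, fun i hi => ?_⟩
  · have := h.edge_inj _ (by omega) _ (by omega) hij
    omega
  · have := h.vertex_inj _ (by omega) _ (by omega) hij
    omega
  · have := h.mem_right (m - 1 - i) (by omega)
    rwa [show m - 1 - i + 1 = m - i by omega] at this
  · have := h.mem_left (m - 1 - i) (by omega)
    rwa [show m - 1 - i = m - (i + 1) by omega] at this ⊢

/-- The new order is `e p, …, e 0, e (p + 1), …, e m`. The connector `v p` is dropped, so `x = v p`
is allowed. -/
theorem rotate (h : IsEdgePath F m e v) (hp : p < m) (hx0 : x ∈ e 0) (hxp : x ∈ e (p + 1))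
    (hx : ∀ i < m, i ≠ p → v i ≠ x) : IsEdgePath F m (rotEdge e p) (rotVertex v p x) := by
  obtain ⟨h1, h2, h3, h4, h5⟩ := h
  refine ⟨fun i hi => ?_, fun i hi j hj hij => ?_, fun i hi j hj hij => ?_,
    fun i hi => ?_, fun i hi => ?_⟩
  · unfold rotEdge; split_ifs <;> exact h1 _ (by omega)
  · unfold rotEdge at hij
    split_ifs at hij <;> have := h2 _ (by omega) _ (by omega) hij <;> omega
  · unfold rotVertex at hij
    split_ifs at hij <;> grind
  · unfold rotVertex rotEdge
    rcases lt_trichotomy i p with hip | rfl | hip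
    · have := h5 (p - 1 - i) (by omega)
      rw [show p - 1 - i + 1 = p - i by omega] at this
      simpa [hip, hip.le]
    · simpa
    · simpa [hip.not_gt, hip.not_ge, hip.ne'] using h4 i hi
  · unfold rotVertex rotEdge
    rcases lt_trichotomy i p with hip | rfl | hip
    · have := h4 (p - 1 - i) (by omega)
      rw [show p - 1 - i = p - (i + 1) by omega] at this
      simpa [hip, Nat.succ_le_of_lt hip, show p - 1 - i = p - (i + 1) by omega]
    · simpa
    · simpa [hip.not_gt, hip.ne', show ¬ i + 1 ≤ p by omega] using h5 i hi

/-- The vertex `x` closes the path into a cycle, which is cut open at `v p`. -/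
theorem cyclicShift (h : IsEdgePath F m e v) (hp : p < m) (hx0 : x ∈ e 0) (hxm : x ∈ e m)
    (hx : ∀ i < m, v i ≠ x) :
    IsEdgePath F m (fun j => if j + p + 1 ≤ m then e (j + p + 1) else e (j + p - m))
      (fun j => if j + p + 1 < m then v (j + p + 1) else
        if j + p + 1 = m then x else v (j + p - m)) := by
  obtain ⟨h1, h2, h3, h4, h5⟩ := h
  refine ⟨fun i hi => ?_, fun i hi j hj hij => ?_, fun i hi j hj hij => ?_,
    fun i hi => ?_, fun i hi => ?_⟩
  · split_ifs <;> exact h1 _ (by omega)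
  · split_ifs at hij <;> have := h2 _ (by omega) _ (by omega) hij <;> omega
  · split_ifs at hij <;> grind
  · rcases lt_trichotomy (i + p + 1) m with hip | hip | hip
    · simpa [hip, hip.le] using h4 _ hip
    · simpa [hip]
    · simpa [hip.not_gt, hip.not_ge, hip.ne'] using h4 (i + p - m) (by omega)
  · rcases lt_trichotomy (i + p + 1) m with hip | hip | hip
    · have := h5 _ hip
      rw [show i + p + 1 + 1 = i + 1 + p + 1 by omega] at this
      simpa [hip, show i + 1 + p + 1 ≤ m by omega]
    · simpa [hip, show ¬ i + 1 + p + 1 ≤ m by omega, show i + 1 + p - m = 0 by omega]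
    · have := h5 (i + p - m) (by omega)
      rw [show i + p - m + 1 = i + 1 + p - m by omega] at this
      simpa [hip.not_gt, hip.ne', show ¬ i + 1 + p + 1 ≤ m by omega]

theorem isFreeEnd (h : IsEdgePath F m e v) (hx0 : x ∈ e 0) (hx : ∀ i < m, v i ≠ x) :
    IsFreeEnd F m x := ⟨e, v, h, hx0, hx⟩

theorem isFreeEnd_last (h : IsEdgePath F m e v) (hxm : x ∈ e m) (hx : ∀ i < m, v i ≠ x) :
    IsFreeEnd F m x :=
  ⟨_, _, h.reverse, by simpa using hxm, fun i hi => hx _ (by omega)⟩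

/-- Rotation releases the connector `v p`, which lies in the new first edge `e p`. -/
theorem isFreeEnd_rotate (h : IsEdgePath F m e v) (hp : p < m) (hx0 : x ∈ e 0)
    (hxp : x ∈ e (p + 1)) (hx : ∀ i < m, v i ≠ x) : IsFreeEnd F m (v p) := by
  refine ⟨_, _, h.rotate hp hx0 hxp fun i hi _ => hx i hi, ?_, fun i hi => ?_⟩
  · simpa [rotEdge] using h.mem_left p hp
  · unfold rotVertex
    split_ifs with h1 h2
    · intro h3
      have := h.vertex_inj _ (by omega) _ hp h3
      omega
    · exact (hx p hp).symm
    · exact fun h3 => h2 (h.vertex_inj _ hi _ hp h3)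

theorem isFreeEnd_rotate_last (h : IsEdgePath F m e v) (hp : p < m) (hxm : x ∈ e m)
    (hxp : x ∈ e p) (hx : ∀ i < m, v i ≠ x) : IsFreeEnd F m (v p) := by
  have := h.reverse.isFreeEnd_rotate (p := m - 1 - p) (x := x) (by omega) (by simpa using hxm)
    (by rwa [show m - (m - 1 - p + 1) = p by omega]) (fun i hi => hx _ (by omega))
  rwa [show m - 1 - (m - 1 - p) = p by omega] at this

theorem isFreeEnd_cyclicShift (h : IsEdgePath F m e v) (hp : p < m) (hx0 : x ∈ e 0)
    (hxm : x ∈ e m) (hx : ∀ i < m, v i ≠ x) : IsFreeEnd F m (v p) := by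
  refine ⟨_, _, h.cyclicShift hp hx0 hxm hx, ?_, fun i hi => ?_⟩
  · simpa [Nat.succ_le_of_lt hp] using h.mem_right p hp
  · split_ifs with h1 h2
    · intro h3
      have := h.vertex_inj _ h1 _ hp h3
      omega
    · exact (hx p hp).symm
    · intro h3
      have := h.vertex_inj _ (by omega) _ hp h3
      omega

/-- Reversing the final segment along a connector lying in the last edge. -/
theorem rotate_last (h : IsEdgePath F m e v) (hp : p < m) (hxm : v p ∈ e m) :
    IsEdgePath F m (fun j => if j + p + 1 ≤ m then e (j + p + 1) else e (m - j))
      (fun j => if j + p + 1 < m then v (j + p + 1) else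
        if j + p + 1 = m then v p else v (m - 1 - j)) := by
  have := h.reverse.rotate (p := m - 1 - p) (x := v p) (by omega) (by simpa using hxm)
    (by rw [show m - (m - 1 - p + 1) = p by omega]; exact h.mem_left p hp)
    (fun i hi hip h3 => by have := h.vertex_inj _ (by omega) _ hp h3; omega)
  convert this using 1
  · funext j
    unfold rotEdge
    by_cases hj : j + p + 1 ≤ m
    · rw [if_pos hj, if_pos (by omega)]; congr 1; omega
    · rw [if_neg hj, if_neg (by omega)]
  · funext j
    unfold rotVertex
    rcases lt_trichotomy (j + p + 1) m with hip | hip | hip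
    · rw [if_pos hip, if_pos (by omega)]; congr 1; omega
    · rw [if_neg (by omega), if_pos hip, if_neg (by omega), if_pos (by omega)]
    · rw [if_neg (by omega), if_neg (by omega), if_neg (by omega), if_neg (by omega)]

theorem rotate_last_ne (hp : p < m)
    (hx : ∀ i < m, v i ≠ x) : ∀ i < m, (fun j => if j + p + 1 < m then v (j + p + 1) else
        if j + p + 1 = m then v p else v (m - 1 - j)) i ≠ x := by
  intro i hi
  dsimp only
  split_ifs <;> exact hx _ (by omega)

theorem rotate_ne (hp : p < m) (hx : ∀ i < m, v i ≠ x) :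
    ∀ i < m, rotVertex v p (v p) i ≠ x := by
  intro i hi
  unfold rotVertex
  split_ifs <;> exact hx _ (by omega)

end IsEdgePath

end EdgePath

/-! ### Counting the free endpoints. -/

section FreeEnds

variable {α : Type*}

open Finset in
/-- The edge set of a longest edge path has more than `r` free endpoints. -/
theorem exists_card_isFreeEnd [DecidableEq α] {F : Finset (Finset α)} {m r : ℕ}
    {e : ℕ → Finset α} {v : ℕ → α} (h : IsEdgePath F m e v) (hF : ∀ f ∈ F, f.card = r)
    (hm : 0 < m) (hmr : m + 2 ≤ r) :
    ∃ W : Finset α, r + 1 ≤ W.card ∧ ∀ w ∈ W, IsFreeEnd F m w := by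
  -- If some ordering closes into a cycle, cutting it anywhere frees every connector, so all of `e 0
  -- ∪ e m` is free; this has more than `r` elements as `e 0 ≠ e m`.
  by_cases hc : ∃ e v, IsEdgePath F m e v ∧ ∃ x, x ∈ e 0 ∧ x ∈ e m ∧ ∀ i < m, v i ≠ x
  · obtain ⟨e, v, h, x, hx0, hxm, hx⟩ := hc
    have hcard0 := hF _ (h.mem_edges 0 (by omega))
    have hcardm := hF _ (h.mem_edges m le_rfl)
    refine ⟨e 0 ∪ e m, ?_, fun w hw => ?_⟩
    · by_contra hlt
      have h1 : e 0 = e 0 ∪ e m := eq_of_subset_of_card_le subset_union_left (by omega)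
      have h2 : e m = e 0 ∪ e m := eq_of_subset_of_card_le subset_union_right (by omega)
      have := h.edge_inj 0 (by omega) m le_rfl (h1.trans h2.symm)
      omega
    · by_cases hv : ∃ i < m, v i = w
      · obtain ⟨i, hi, rfl⟩ := hv
        exact h.isFreeEnd_cyclicShift hi hx0 hxm hx
      · push Not at hv
        rcases mem_union.1 hw with hw | hw
        · exact h.isFreeEnd hw hv
        · exact h.isFreeEnd_last hw hv
  have hD : ∀ e v, IsEdgePath F m e v → ∀ x, (∀ i < m, v i ≠ x) → x ∈ e 0 → x ∉ e m :=
    fun e v h x hx h0 hm => hc ⟨e, v, h, x, h0, hm, hx⟩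
  set V := (range m).image v with hV
  have hmemV : ∀ x, x ∉ V ↔ ∀ i < m, v i ≠ x := fun x => by simp [hV]
  have hVcard : V.card = m := by
    rw [card_image_of_injOn, card_range]
    intro i hi j hj hij
    exact h.vertex_inj i (by simpa using hi) j (by simpa using hj) hij
  -- `Q` indexes the connectors counted twice when `V` is removed from both end edges. The index `m
  -- - 1` is left out: it accounts for the spare `1` in the count, and `e (p + 2)` must exist for
  -- the rotations.
  set Q := (range (m - 1)).filter fun p => v p ∈ e 0 ∧ v p ∈ e m with hQ
  have hQm : ∀ p ∈ Q, p + 1 < m ∧ v p ∈ e 0 ∧ v p ∈ e m := fun p hp => by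
    simp only [hQ, mem_filter, mem_range] at hp
    exact ⟨by omega, hp.2⟩
  -- `e (p + 1)` is an end of an edge path with the same connectors and other end `e 0`
  have hB : ∀ p ∈ Q, ∀ y ∈ e (p + 1), y ∉ V → IsFreeEnd F m y ∧ y ∉ e 0 := by
    intro p hp y hy hyV
    obtain ⟨hpm, -, hvm⟩ := hQm p hp
    have h' := h.rotate_last (p := p) (by omega) hvm
    have hne := IsEdgePath.rotate_last_ne (p := p) (by omega) ((hmemV y).1 hyV)
    have hy0 : y ∈ (fun j => if j + p + 1 ≤ m then e (j + p + 1) else e (m - j)) 0 := by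
      simpa [hpm.le] using hy
    refine ⟨h'.isFreeEnd hy0 hne, ?_⟩
    have := hD _ _ h' y hne hy0
    simpa using this
  -- Were `v (p + 1)` in `e 0`, rotating along it would put `e (p + 1)` first and keep `e m` last,
  -- and `x` would close a cycle.
  have hA : ∀ p ∈ Q, ∀ x ∈ e (p + 1), x ∈ e m → x ∉ V →
      IsFreeEnd F m (v (p + 1)) ∧ v (p + 1) ∉ e 0 := by
    intro p hp x hx hxm hxV
    obtain ⟨hpm, -, hvm⟩ := hQm p hp
    rw [hmemV] at hxV
    refine ⟨h.isFreeEnd_rotate_last hpm hxm hx hxV, fun h0 => ?_⟩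
    have h' := h.rotate hpm h0 (h.mem_right _ hpm)
      (fun i hi hip h3 => hip (h.vertex_inj i hi _ hpm h3))
    refine hD _ _ h' x (IsEdgePath.rotate_ne hpm hxV) (by simpa [rotEdge] using hx) ?_
    simpa [rotEdge, hpm.not_ge] using hxm
  have hC : ∀ p ∈ Q, ∀ q ∈ Q, p < q → ∀ y ∈ e (p + 1), y ∈ e (q + 1) → y ∉ V →
      IsFreeEnd F m (v q) := by
    intro p hp q hq hpq y hyp hyq hyV
    obtain ⟨hpm, -, hvm⟩ := hQm p hp
    obtain ⟨hqm, -, -⟩ := hQm q hq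
    have h' := h.rotate_last (p := p) (by omega) hvm
    have hne := IsEdgePath.rotate_last_ne (p := p) (by omega) ((hmemV y).1 hyV)
    have := h'.isFreeEnd_rotate (p := q - p - 1) (x := y) (by omega) (by simpa [hpm.le] using hyp)
      (by
        rw [if_pos (by omega), show q - p - 1 + 1 + p + 1 = q + 1 by omega]
        exact hyq) hne
    rwa [if_pos (by omega), show q - p - 1 + p + 1 = q by omega] at this
  have hy : ∀ p ∈ Q, ∃ y ∈ e (p + 1), y ∉ V := by
    intro p hp
    obtain ⟨hpm, -⟩ := hQm p hp
    exact exists_mem_notMem_of_card_lt_card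
      (by rw [hVcard, hF _ (h.mem_edges (p + 1) (by omega))]; omega)
  have : Nonempty α := ⟨v 0⟩
  choose! y hye hyV using hy
  classical
  -- Each `p ∈ Q` is repaid by its own free endpoint outside `(e 0 ∪ e m) \ V`. The choices never
  -- collide: `v (p + 1) ∉ e 0` while `v q ∈ e 0`, and `y p = y q` with `p < q` would make `v q`
  -- free by `hC`.
  let g : ℕ → α := fun p =>
    if ∃ x ∈ e (p + 1), x ∈ e m ∧ x ∉ V then v (p + 1) else
      if IsFreeEnd F m (v p) then v p else y p
  have hvV : ∀ i < m, v i ∈ V := fun i hi => by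
    by_contra hi'
    exact (hmemV _).1 hi' i hi rfl
  have hgfree : ∀ p ∈ Q, IsFreeEnd F m (g p) := by
    intro p hp
    simp only [g]
    split_ifs with h1 h2
    · obtain ⟨x, hx, hxm, hxV⟩ := h1
      exact (hA p hp x hx hxm hxV).1
    · exact h2
    · exact (hB p hp _ (hye p hp) (hyV p hp)).1
  have hgout : ∀ p ∈ Q, g p ∉ (e 0 ∪ e m) \ V := by
    intro p hp
    obtain ⟨hpm, -⟩ := hQm p hp
    simp only [g]
    split_ifs with h1 h2
    · simp [hvV (p + 1) hpm]
    · simp [hvV p (by omega)]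
    · rw [mem_sdiff, mem_union]
      rintro ⟨h3 | h3, -⟩
      · exact (hB p hp _ (hye p hp) (hyV p hp)).2 h3
      · exact h1 ⟨_, hye p hp, h3, hyV p hp⟩
  have hginj : Set.InjOn g Q := by
    have key : ∀ p ∈ Q, ∀ q ∈ Q, p < q → g p ≠ g q := by
      intro p hp q hq hpq heq
      obtain ⟨hpm, -⟩ := hQm p hp
      obtain ⟨hqm, hq0, -⟩ := hQm q hq
      simp only [g] at heq
      split_ifs at heq with h1 h2 h3 h4 h5 h6 h7
      · have := h.vertex_inj _ hpm _ hqm heq; omega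
      · obtain ⟨x, hx, hxm, hxV⟩ := h1
        exact (hA p hp x hx hxm hxV).2 (heq ▸ hq0)
      · exact hyV q hq (heq ▸ hvV _ hpm)
      · have := h.vertex_inj _ (by omega) _ hqm heq; omega
      · have := h.vertex_inj _ (by omega) _ (by omega) heq; omega
      · exact hyV q hq (heq ▸ hvV p (by omega))
      · exact hyV p hp (heq ▸ hvV _ hqm)
      · exact hyV p hp (heq ▸ hvV q (by omega))
      · rename_i hnot
        exact hnot (hC p hp q hq hpq (y p) (hye p hp) (heq ▸ hye q hq) (hyV p hp))
    intro p hp q hq heq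
    rcases lt_trichotomy p q with hlt | rfl | hlt
    · exact absurd heq (key p hp q hq hlt)
    · rfl
    · exact absurd heq.symm (key q hq p hp hlt)
  refine ⟨(e 0 \ V ∪ e m \ V) ∪ Q.image g, ?_, fun w hw => ?_⟩
  · have hd1 : Disjoint (e 0 \ V) (e m \ V) := by
      rw [disjoint_left]
      intro x hx hx'
      rw [mem_sdiff] at hx hx'
      exact hD e v h x ((hmemV x).1 hx.2) hx.1 hx'.1
    have hd2 : Disjoint (e 0 \ V ∪ e m \ V) (Q.image g) := by
      rw [disjoint_right]
      intro x hx
      obtain ⟨p, hp, rfl⟩ := mem_image.1 hx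
      rw [← union_sdiff_distrib]
      exact hgout p hp
    rw [card_union_of_disjoint hd2, card_union_of_disjoint hd1, card_image_of_injOn hginj]
    have h0 := card_sdiff_add_card_inter (e 0) V
    have h1 := card_sdiff_add_card_inter (e m) V
    rw [hF _ (h.mem_edges 0 (by omega))] at h0
    rw [hF _ (h.mem_edges m le_rfl)] at h1
    -- The end edges lose at most `m + Q.card + 1` vertices to `V`; the image of `g` restores
    -- `Q.card`, leaving `2 * r - m - 1 ≥ r + 1`.
    have h2 := card_union_add_card_inter (e 0 ∩ V) (e m ∩ V)
    have h3 : (e 0 ∩ V ∪ e m ∩ V).card ≤ m :=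
      hVcard ▸ card_le_card (union_subset inter_subset_right inter_subset_right)
    have h4 : ((e 0 ∩ V) ∩ (e m ∩ V)).card ≤ Q.card + 1 := by
      have hsub : (e 0 ∩ V) ∩ (e m ∩ V) ⊆ insert (v (m - 1)) (Q.image v) := by
        intro x hx
        simp only [mem_inter] at hx
        obtain ⟨⟨hx0, hxV⟩, hxm, -⟩ := hx
        obtain ⟨i, hi, rfl⟩ := mem_image.1 hxV
        rw [mem_range] at hi
        rw [mem_insert]
        by_cases him : i = m - 1
        · exact Or.inl (by rw [him])
        · refine Or.inr (mem_image_of_mem _ ?_)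
          simp only [hQ, mem_filter, mem_range]
          exact ⟨by omega, hx0, hxm⟩
      exact (card_le_card hsub).trans ((card_insert_le _ _).trans
        (Nat.succ_le_succ card_image_le))
    omega
  · simp only [mem_union, mem_sdiff, mem_image] at hw
    rcases hw with (⟨hw, hwV⟩ | ⟨hw, hwV⟩) | ⟨p, hp, rfl⟩
    · exact h.isFreeEnd hw ((hmemV w).1 hwV)
    · exact h.isFreeEnd_last hw ((hmemV w).1 hwV)
    · exact hgfree p hp

/-- If `F` has exactly the edges of an edge path that cannot be prolonged in `E`, then all edges at
a free endpoint belong to `F`. -/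
theorem IsFreeEnd.mem_of_mem {E F : Finset (Finset α)} {m : ℕ} {w : α} {f : Finset α}
    (hw : IsFreeEnd F m w) (hFE : F ⊆ E) (hmax : ¬ ∃ e v, IsEdgePath E (m + 1) e v)
    (hf : f ∈ E) (hwf : w ∈ f) : f ∈ F := by
  by_contra hfF
  obtain ⟨e, v, h, hw0, hwv⟩ := hw
  refine hmax ⟨fun j => if j = 0 then f else e (j - 1), fun j => if j = 0 then w else v (j - 1),
    fun i hi => ?_, fun i hi j hj hij => ?_, fun i hi j hj hij => ?_, fun i hi => ?_,
    fun i hi => ?_⟩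
  · split_ifs
    · exact hf
    · exact hFE (h.mem_edges _ (by omega))
  · split_ifs at hij
    · omega
    · exact absurd (hij ▸ h.mem_edges _ (by omega)) hfF
    · exact absurd (hij ▸ h.mem_edges _ (by omega)) hfF
    · have := h.edge_inj _ (by omega) _ (by omega) hij
      omega
  · split_ifs at hij
    · omega
    · exact absurd hij.symm (hwv _ (by omega))
    · exact absurd hij (hwv _ (by omega))
    · have := h.vertex_inj _ (by omega) _ (by omega) hij
      omega
  · split_ifs
    · exact hwf
    · exact h.mem_left _ (by omega)
  · rw [if_neg (by omega)]
    split_ifs with h0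
    · simpa [h0] using hw0
    · have := h.mem_right (i - 1) (by omega)
      rwa [show i - 1 + 1 = i + 1 - 1 by omega] at this

/-! ### The upper bound by induction on the vertex set. -/

/-- The value of the Turán number of Berge paths of length `k`. -/
def bergePathBound (r k n : ℕ) : ℕ := n / (r + 1) * (k - 1) + if n % (r + 1) = r then 1 else 0

theorem bergePathBound_add_succ (r k n : ℕ) :
    bergePathBound r k (n + (r + 1)) = bergePathBound r k n + (k - 1) := by
  unfold bergePathBound
  rw [Nat.add_div_right _ (Nat.succ_pos r), Nat.add_mod_right]
  ring

/-- Adding `r` vertices either creates the leftover edge or completes a block; the latter may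
destroy a leftover edge, so `k - 1 ≥ 2` is needed. -/
theorem bergePathBound_add_le (r k n : ℕ) (hk : 3 ≤ k) (hr : 0 < r) :
    bergePathBound r k n + 1 ≤ bergePathBound r k (n + r) := by
  unfold bergePathBound
  obtain ⟨q, s, hs, rfl⟩ : ∃ q s, s < r + 1 ∧ n = s + (r + 1) * q :=
    ⟨n / (r + 1), n % (r + 1), Nat.mod_lt _ (Nat.succ_pos r), (Nat.mod_add_div _ _).symm⟩
  rw [Nat.add_mul_div_left _ _ (Nat.succ_pos r), Nat.add_mul_mod_self_left,
    Nat.div_eq_of_lt hs, Nat.mod_eq_of_lt hs]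
  rcases Nat.eq_zero_or_pos s with rfl | hs0
  · rw [show 0 + (r + 1) * q + r = r + (r + 1) * q by ring,
      Nat.add_mul_div_left _ _ (Nat.succ_pos r), Nat.add_mul_mod_self_left,
      Nat.div_eq_of_lt (Nat.lt_succ_self r), Nat.mod_eq_of_lt (Nat.lt_succ_self r)]
    simp [hr.ne]
  · obtain ⟨t, rfl⟩ := Nat.exists_eq_add_of_le' hs0
    rw [show t + 1 + (r + 1) * q + r = t + (r + 1) * (q + 1) by ring,
      Nat.add_mul_div_left _ _ (Nat.succ_pos r), Nat.div_eq_of_lt (by omega)]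
    have : (0 + (q + 1)) * (k - 1) = (0 + q) * (k - 1) + (k - 1) := by ring
    rw [this]
    split_ifs <;> omega

open Finset in
/-- An `r`-uniform family on `S` without an edge path of `k` edges has at most
`bergePathBound r k S.card` members. -/
theorem card_le_bergePathBound [DecidableEq α] {k r : ℕ} (hk : 3 ≤ k) (hkr : k ≤ r)
    (S : Finset α) (E : Finset (Finset α)) (hES : ∀ f ∈ E, f ⊆ S) (hEr : ∀ f ∈ E, f.card = r)
    (hfree : ¬ ∃ e v, IsEdgePath E (k - 1) e v) : E.card ≤ bergePathBound r k S.card := by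
  classical
  induction hs : S.card using Nat.strong_induction_on generalizing S E with
  | _ s ih =>
  have step : ∀ (W : Finset α) (F : Finset (Finset α)), W ⊆ S → 0 < W.card →
      (∀ w ∈ W, ∀ f ∈ E, w ∈ f → f ∈ F) →
      E.card ≤ bergePathBound r k (s - W.card) + F.card := by
    intro W F hWS hW hWF
    have hc : (S \ W).card = s - W.card := by rw [card_sdiff_of_subset hWS, hs]
    have hle := card_le_card hWS
    have := ih (s - W.card) (by omega) (S \ W) (E \ F) (fun f hf => ?_)
      (fun f hf => hEr f (mem_sdiff.1 hf).1)
      (fun ⟨e, v, h⟩ => hfree ⟨e, v, h.mono sdiff_subset⟩) hc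
    · have := card_le_card_sdiff_add_card (s := E) (t := F)
      omega
    · intro x hx
      rw [mem_sdiff] at hf ⊢
      exact ⟨hES f hf.1 hx, fun hxW => hf.2 (hWF x hxW f hf.1 hx)⟩
  rcases E.eq_empty_or_nonempty with rfl | ⟨f₀, hf₀⟩
  · simp
  have hex0 : ∃ e v, IsEdgePath E 0 e v := by
    obtain ⟨x, -⟩ : f₀.Nonempty := card_pos.1 (by rw [hEr _ hf₀]; omega)
    exact ⟨fun _ => f₀, fun _ => x, by constructor <;> simp [hf₀]⟩
  obtain ⟨m, hmk, ⟨e, v, h⟩, hmax⟩ : ∃ m, m + 1 ≤ k - 1 ∧ (∃ e v, IsEdgePath E m e v) ∧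
      ¬ ∃ e v, IsEdgePath E (m + 1) e v := by
    by_contra hcon
    have hall : ∀ m, m ≤ k - 1 → ∃ e v, IsEdgePath E m e v := by
      intro m
      induction m with
      | zero => exact fun _ => hex0
      | succ m ihm =>
        intro hm
        by_contra hnot
        exact hcon ⟨m, hm, ihm (by omega), hnot⟩
    exact hfree (hall _ le_rfl)
  set F := (range (m + 1)).image e with hFdef
  have hFcard : F.card = m + 1 := by
    rw [card_image_of_injOn, card_range]
    intro i hi j hj hij
    simp only [coe_range, Set.mem_Iio] at hi hj
    exact h.edge_inj i (by omega) j (by omega) hij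
  have hFE : F ⊆ E := by
    intro f hf
    obtain ⟨i, hi, rfl⟩ := mem_image.1 hf
    exact h.mem_edges i (by rw [mem_range] at hi; omega)
  have hF : IsEdgePath F m e v :=
    ⟨fun i hi => mem_image_of_mem _ (by rw [mem_range]; omega), h.edge_inj, h.vertex_inj,
      h.mem_left, h.mem_right⟩
  have hfreeS : ∀ w, IsFreeEnd F m w → w ∈ S := by
    rintro w ⟨e', v', h', hw, -⟩
    exact hES _ (hFE (h'.mem_edges 0 (by omega))) hw
  have hmem : ∀ w, IsFreeEnd F m w → ∀ f ∈ E, w ∈ f → f ∈ F :=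
    fun w hw f hf hwf => hw.mem_of_mem hFE hmax hf hwf
  rcases Nat.eq_zero_or_pos m with rfl | hm
  · have hr := hEr _ (hFE (hF.mem_edges 0 le_rfl))
    have hsub := hES _ (hFE (hF.mem_edges 0 le_rfl))
    have := step (e 0) F hsub (by omega)
      (fun w hw => hmem w (hF.isFreeEnd hw (by simp)))
    have hb := bergePathBound_add_le r k (s - r) hk (by omega)
    have hle := card_le_card hsub
    rw [Nat.sub_add_cancel (by omega)] at hb
    rw [hr] at this
    omega
  · obtain ⟨W, hWr, hW⟩ := exists_card_isFreeEnd hF (fun f hf => hEr f (hFE hf)) hm (by omega)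
    obtain ⟨W', hW'W, hW'⟩ := exists_subset_card_eq hWr
    have hsub : W' ⊆ S := fun w hw => hfreeS w (hW w (hW'W hw))
    have := step W' F hsub (by omega) (fun w hw => hmem w (hW w (hW'W hw)))
    have hle := card_le_card hsub
    have hb := bergePathBound_add_succ r k (s - (r + 1))
    rw [Nat.sub_add_cancel (by omega)] at hb
    rw [hW'] at this
    omega

end FreeEnds

/-! ### From edge paths to Berge paths. -/

namespace Hypergraph

open Finset in
/-- An edge path with `k ≤ r` edges of size `r` extends to a Berge path of length `k`. -/
theorem exists_bergePath_of_isEdgePath {α : Type*} [DecidableEq α] {E : Finset (Finset α)}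
    {k r : ℕ} (hk : 2 ≤ k) (hkr : k ≤ r) (hE : ∀ f ∈ E, f.card = r) {e : ℕ → Finset α} {v : ℕ → α}
    (h : IsEdgePath E (k - 1) e v) :
    ∃ w : Fin (k + 1) → α, Function.Injective w ∧
      ∀ i : Fin k, w i.castSucc ∈ e i ∧ w i.succ ∈ e i := by
  set V := (range (k - 1)).image v with hV
  have hmemV : ∀ x, x ∉ V ↔ ∀ i < k - 1, v i ≠ x := fun x => by simp [hV]
  have hVcard : V.card ≤ k - 1 := card_image_le.trans (card_range _).le
  have h0 := hE _ (h.mem_edges 0 (by omega))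
  have h1 := hE _ (h.mem_edges (k - 1) le_rfl)
  obtain ⟨a, b, ha, haV, hb, hbV, hab⟩ :
      ∃ a b, a ∈ e 0 ∧ a ∉ V ∧ b ∈ e (k - 1) ∧ b ∉ V ∧ a ≠ b := by
    obtain ⟨a, ha, haV⟩ := exists_mem_notMem_of_card_lt_card (s := V) (t := e 0) (by omega)
    obtain ⟨b, hb, hbV⟩ := exists_mem_notMem_of_card_lt_card (s := V) (t := e (k - 1)) (by omega)
    -- If the only spare vertex of both end edges is `a`, each is contained in `insert a V`, of size
    -- at most `k ≤ r`, so the two edges coincide.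
    by_contra hcon
    push Not at hcon
    have hba := hcon a b ha haV hb hbV
    subst hba
    have hc : (insert a V).card ≤ r := (card_insert_le _ _).trans (by omega)
    have e0 : e 0 = insert a V := by
      refine eq_of_subset_of_card_le (fun x hx => ?_) (by omega)
      by_cases hxV : x ∈ V
      · exact mem_insert_of_mem hxV
      · rw [hcon x a hx hxV hb hbV]; exact mem_insert_self _ _
    have e1 : e (k - 1) = insert a V := by
      refine eq_of_subset_of_card_le (fun x hx => ?_) (by omega)
      by_cases hxV : x ∈ V
      · exact mem_insert_of_mem hxV
      · rw [← hcon a x ha haV hx hxV]; exact mem_insert_self _ _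
    have := h.edge_inj 0 (by omega) (k - 1) le_rfl (e0.trans e1.symm)
    omega
  rw [hmemV] at haV hbV
  refine ⟨fun i => if (i : ℕ) = 0 then a else if (i : ℕ) = k then b else v (i - 1),
    fun i j hij => ?_, fun i => ⟨?_, ?_⟩⟩
  · have hi := i.2
    have hj := j.2
    dsimp only at hij
    apply Fin.ext
    split_ifs at hij with h1 h2 h3 h4 h5 h6 h7
    · omega
    · exact absurd hij hab
    · exact absurd hij.symm (haV _ (by omega))
    · exact absurd hij.symm hab
    · omega
    · exact absurd hij.symm (hbV _ (by omega))
    · exact absurd hij (haV _ (by omega))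
    · exact absurd hij (hbV _ (by omega))
    · have := h.vertex_inj _ (by omega) _ (by omega) hij
      omega
  · have hi := i.2
    simp only [Fin.val_castSucc]
    split_ifs with h1 h2
    · rwa [h1]
    · omega
    · have := h.mem_right (i - 1) (by omega)
      rwa [Nat.sub_add_cancel (by omega)] at this
  · have hi := i.2
    simp only [Fin.val_succ, Nat.succ_ne_zero, if_false]
    split_ifs with h1
    · rwa [show (i : ℕ) = k - 1 by omega]
    · exact h.mem_left i (by omega)

theorem containsCopy_of_bergePath {n k : ℕ} {H : Hypergraph (Fin n)} {w : Fin (k + 1) → Fin n}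
    {e : Fin k → Set (Fin n)} (hw : Function.Injective w) (he : Function.Injective e)
    (hmem : ∀ i : Fin k, w i.castSucc ∈ e i ∧ w i.succ ∈ e i) (hV : H.vertexSet = Set.univ)
    (hE : ∀ i, e i ∈ H.edgeSet) : ∃ B ∈ bergePaths k, H.ContainsCopy B := by
  have hn : Nonempty (Fin n) := ⟨w 0⟩
  have hinj : Function.Injective (Fin.val : Fin n → ℕ) := Fin.val_injective
  refine ⟨⟨Set.range (fun i => (w i : ℕ)) ∪ ⋃ i, Fin.val '' e i,
    Set.range fun i => Fin.val '' e i, ?_⟩, ⟨fun i => w i, fun i => Fin.val '' e i,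
      hinj.comp hw, hinj.image_injective.comp he, fun i => ⟨?_, ?_⟩, rfl, rfl⟩,
      -- The copy in `ℕ` is the image under `Fin.val`; its vertices lie in the range of `Fin.val`,
      -- where the inverse is injective.
      Function.invFun Fin.val, ?_, ?_, ?_⟩
  · rintro _ ⟨i, rfl⟩
    exact (Set.subset_iUnion (fun i => Fin.val '' e i) i).trans Set.subset_union_right
  · exact Set.mem_image_of_mem _ (hmem i).1
  · exact Set.mem_image_of_mem _ (hmem i).2
  · refine Set.InjOn.mono (s₂ := Set.range (Fin.val : Fin n → ℕ)) ?_ ?_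
    · rintro x hx
      rcases hx with ⟨i, rfl⟩ | hx
      · exact ⟨_, rfl⟩
      · obtain ⟨i, y, -, rfl⟩ := Set.mem_iUnion.1 hx
        exact ⟨_, rfl⟩
    · rintro _ ⟨x, rfl⟩ _ ⟨y, rfl⟩ hxy
      rw [Function.leftInverse_invFun hinj x, Function.leftInverse_invFun hinj y] at hxy
      rw [hxy]
  · rw [hV]
    exact Set.subset_univ _
  · rintro _ ⟨_, ⟨i, rfl⟩, rfl⟩
    rw [Set.image_image]
    simpa [Function.leftInverse_invFun hinj _] using hE i

theorem ncard_edgeSet_le_bergePathBound {n k r : ℕ} (hk : 3 ≤ k) (hkr : k ≤ r)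
    {H : Hypergraph (Fin n)} (hV : H.vertexSet = Set.univ) (hr : H.IsUniform r)
    (hfree : H.IsFree (bergePaths k)) : H.edgeSet.ncard ≤ bergePathBound r k n := by
  classical
  let E : Finset (Finset (Fin n)) := Finset.univ.filter fun f => (f : Set (Fin n)) ∈ H.edgeSet
  have hE : ∀ f, f ∈ E ↔ (f : Set (Fin n)) ∈ H.edgeSet := fun f => by simp [E]
  have hset : H.edgeSet = (fun f : Finset (Fin n) => (f : Set (Fin n))) '' E := by
    ext s
    refine ⟨fun hs => ⟨s.toFinset, ?_, by simp⟩, ?_⟩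
    · rw [Finset.mem_coe, hE]
      simpa using hs
    · rintro ⟨f, hf, rfl⟩
      exact (hE f).1 hf
  have hEr : ∀ f ∈ E, f.card = r := fun f hf => by
    have := hr _ ((hE f).1 hf)
    rw [Set.encard_coe_eq_coe_finsetCard] at this
    exact_mod_cast this
  rw [hset, Set.ncard_image_of_injective _ Finset.coe_injective, Set.ncard_coe_finset]
  have := card_le_bergePathBound hk hkr Finset.univ E (fun f _ => Finset.subset_univ f) hEr ?_
  · simpa using this
  · rintro ⟨e, v, h⟩
    obtain ⟨w, hw, hmem⟩ := exists_bergePath_of_isEdgePath (by omega) hkr hEr h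
    obtain ⟨B, hB, hcopy⟩ := containsCopy_of_bergePath (H := H)
      (e := fun i : Fin k => (e i : Set (Fin n))) hw
      (fun i j hij => Fin.ext (h.edge_inj i (by omega) j (by omega) (Finset.coe_injective hij)))
      hmem hV (fun i => (hE _).1 (h.mem_edges i (by omega)))
    exact hfree B hB hcopy

/-! ### The extremal block construction. -/

/-- The vertices with quotient `b` and remainder different from `j` modulo `r + 1`. -/
def blockEdge (n r : ℕ) (p : ℕ × ℕ) : Set (Fin n) :=
  {x | (x : ℕ) / (r + 1) = p.1 ∧ (x : ℕ) % (r + 1) ≠ p.2}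

/-- The indices of the edges of the extremal hypergraph. -/
def blockIndex (n r k : ℕ) : Finset (ℕ × ℕ) :=
  Finset.range (n / (r + 1)) ×ˢ Finset.range (k - 1) ∪
    if n % (r + 1) = r then {(n / (r + 1), r)} else ∅

theorem mem_blockIndex {n r k : ℕ} {p : ℕ × ℕ} : p ∈ blockIndex n r k ↔
    (p.1 < n / (r + 1) ∧ p.2 < k - 1) ∨
      n % (r + 1) = r ∧ p.1 = n / (r + 1) ∧ p.2 = r := by
  unfold blockIndex
  split_ifs with h <;> simp [h, Prod.ext_iff, or_comm]

theorem card_blockIndex (n r k : ℕ) : (blockIndex n r k).card = bergePathBound r k n := by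
  unfold blockIndex bergePathBound
  rw [Finset.card_union_of_disjoint]
  · split_ifs <;> simp
  · rw [Finset.disjoint_right]
    intro p hp
    split_ifs at hp
    · rw [Finset.mem_singleton] at hp
      simp [hp]
    · simp at hp

/-- For the incomplete last block the omitted position `r` would be the vertex `n` itself; every
other position exists. -/
theorem add_lt_of_mem_blockIndex {n r k : ℕ} {p : ℕ × ℕ} (hp : p ∈ blockIndex n r k) {x : ℕ}
    (hx : x ≤ r) (hxp : x ≠ p.2) : x + (r + 1) * p.1 < n := by
  have hn := Nat.mod_add_div n (r + 1)
  rcases mem_blockIndex.1 hp with ⟨h1, -⟩ | ⟨h1, h2, h3⟩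
  · have := Nat.mul_le_mul_left (r + 1) (Nat.succ_le_of_lt h1)
    rw [Nat.mul_succ] at this
    omega
  · rw [h2]
    omega

theorem snd_le_of_mem_blockIndex {n r k : ℕ} (hkr : k ≤ r) {p : ℕ × ℕ}
    (hp : p ∈ blockIndex n r k) : p.2 ≤ r := by
  rcases mem_blockIndex.1 hp with ⟨-, h⟩ | ⟨-, -, h⟩ <;> omega

theorem mem_blockEdge_of_val_eq {n r x : ℕ} {p : ℕ × ℕ} {y : Fin n} (hx : x ≤ r)
    (hy : (y : ℕ) = x + (r + 1) * p.1) (q : ℕ × ℕ) :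
    y ∈ blockEdge n r q ↔ p.1 = q.1 ∧ x ≠ q.2 := by
  simp only [blockEdge, Set.mem_ofPred_eq, hy, Nat.add_mul_div_left _ _ (Nat.succ_pos r),
    Nat.add_mul_mod_self_left, Nat.div_eq_of_lt (Nat.lt_succ_of_le hx),
    Nat.mod_eq_of_lt (Nat.lt_succ_of_le hx), zero_add]

theorem encard_blockEdge {n r k : ℕ} (hkr : k ≤ r) {p : ℕ × ℕ} (hp : p ∈ blockIndex n r k) :
    (blockEdge n r p).encard = r := by
  have h : (Fin.val '' blockEdge n r p) =
      (fun x => x + (r + 1) * p.1) '' ((Finset.range (r + 1)).erase p.2 : Finset ℕ) := by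
    ext y
    simp only [Set.mem_image, Finset.mem_coe, Finset.mem_erase, Finset.mem_range]
    constructor
    · rintro ⟨x, ⟨h1, h2⟩, rfl⟩
      exact ⟨x % (r + 1), ⟨h2, Nat.mod_lt _ (Nat.succ_pos r)⟩, by rw [← h1, Nat.mod_add_div]⟩
    · rintro ⟨x, ⟨h1, h2⟩, rfl⟩
      exact ⟨⟨_, add_lt_of_mem_blockIndex hp (by omega) h1⟩,
        (mem_blockEdge_of_val_eq (p := p) (by omega) rfl p).2 ⟨rfl, h1⟩, rfl⟩
  rw [← Fin.val_injective.encard_image, h, Function.Injective.encard_image,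
    Set.encard_coe_eq_coe_finsetCard, Finset.card_erase_of_mem, Finset.card_range]
  · simp
  · have := snd_le_of_mem_blockIndex hkr hp
    simp; omega
  · intro a b hab
    simpa using hab

theorem injOn_blockEdge {n r k : ℕ} (hk : 2 ≤ k) (hkr : k ≤ r) :
    Set.InjOn (blockEdge n r) (blockIndex n r k) := by
  intro p hp q hq hpq
  have key : ∀ x ≤ r, x ≠ p.2 → p.1 = q.1 ∧ x ≠ q.2 := by
    intro x hx hxp
    let y : Fin n := ⟨_, add_lt_of_mem_blockIndex hp hx hxp⟩
    have hy : y ∈ blockEdge n r p := (mem_blockEdge_of_val_eq hx rfl p).2 ⟨rfl, hxp⟩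
    rw [hpq] at hy
    exact (mem_blockEdge_of_val_eq (p := p) hx rfl q).1 hy
  refine Prod.ext ?_ ?_
  · by_cases h0 : p.2 = 0
    · exact (key 1 (by omega) (by omega)).1
    · exact (key 0 (by omega) (by omega)).1
  · by_contra hne
    exact (key q.2 (snd_le_of_mem_blockIndex hkr hq) (Ne.symm hne)).2 rfl

/-- Disjoint blocks of `r + 1` vertices spanning `k - 1` edges each, and one more edge when `r`
vertices are left. -/
def blockHypergraph (n r k : ℕ) : Hypergraph (Fin n) where
  vertexSet := Set.univ
  edgeSet := blockEdge n r '' blockIndex n r k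
  subset_vertexSet_of_mem_edgeSet' _ _ := Set.subset_univ _

theorem isFree_blockHypergraph {n r k : ℕ} (hk : 3 ≤ k) :
    (blockHypergraph n r k).IsFree (bergePaths k) := by
  rintro B ⟨v, e, -, he, hve, hBE, -⟩ ⟨f, hf, -, hE⟩
  have hedge : ∀ i, e i ∈ B.edgeSet := fun i => hBE ▸ Set.mem_range_self i
  have hp : ∀ i, ∃ p ∈ blockIndex n r k, blockEdge n r p = f '' e i := fun i =>
    hE (image_mem_edgeSet_image (hedge i))
  choose p hpm hpe using hp
  have hpinj : Function.Injective p := by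
    intro i j hij
    apply he
    have h : f '' e i = f '' e j := by rw [← hpe, ← hpe, hij]
    exact (hf.image_eq_image_iff (B.subset_vertexSet_of_mem_edgeSet (hedge i))
      (B.subset_vertexSet_of_mem_edgeSet (hedge j))).1 h
  -- Consecutive edges share a vertex, hence a block; the path therefore stays in one block.
  have hfst : ∀ i : ℕ, ∀ hi : i < k, (p ⟨i, hi⟩).1 = (p ⟨0, by omega⟩).1 := by
    intro i
    induction i with
    | zero => exact fun _ => rfl
    | succ i ih =>
      intro hi
      rw [← ih (by omega)]
      have h1 := Set.mem_image_of_mem f (hve ⟨i + 1, hi⟩).1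
      have h2 := Set.mem_image_of_mem f (hve ⟨i, by omega⟩).2
      rw [← hpe] at h1 h2
      exact h1.1.symm.trans h2.1
  have hsnd : Function.Injective fun i => (p i).2 := fun i j hij =>
    hpinj (Prod.ext ((hfst i i.2).trans (hfst j j.2).symm) hij)
  by_cases hlast : (p ⟨0, by omega⟩).1 < n / (r + 1)
  · have hlt : ∀ i, (p i).2 < k - 1 := by
      intro i
      rcases mem_blockIndex.1 (hpm i) with h | h
      · exact h.2
      · have := hfst i i.2
        rw [Fin.eta] at this
        omega
    have := Fintype.card_le_of_injective (fun i => (⟨(p i).2, hlt i⟩ : Fin (k - 1)))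
      (fun i j hij => hsnd (Fin.mk.inj_iff.1 hij))
    simp only [Fintype.card_fin] at this
    omega
  · have hr : ∀ i, (p i).2 = r := by
      intro i
      have := hfst i i.2
      rw [Fin.eta] at this
      rcases mem_blockIndex.1 (hpm i) with h | h <;> omega
    have := hsnd (a₁ := ⟨0, by omega⟩) (a₂ := ⟨1, by omega⟩) ((hr _).trans (hr _).symm)
    simp at this

theorem isGreatest_bergePathBound {n k r : ℕ} (hk : 3 ≤ k) (hkr : k ≤ r) :
    IsGreatest (freeEdgeCounts r n (bergePaths k)) (bergePathBound r k n) := by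
  refine ⟨⟨blockHypergraph n r k, rfl, ?_, isFree_blockHypergraph hk, ?_⟩, ?_⟩
  · rintro _ ⟨p, hp, rfl⟩
    exact encard_blockEdge hkr hp
  · rw [← card_blockIndex, ← Set.ncard_coe_finset]
    exact (injOn_blockEdge (by omega) hkr).ncard_image
  · rintro _ ⟨H, hV, hr, hfree, rfl⟩
    exact ncard_edgeSet_le_bergePathBound hk hkr hV hr hfree

end Hypergraph

/-! ### The indicator as a remainder condition, and the conclusion. -/

theorem posMultiplesIndicator_succ_succ (r n : ℕ) :
    posMultiplesIndicator (r + 1) (n + 1) = if n % (r + 1) = r then 1 else 0 := by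
  have h : (∃ j : ℕ, 0 < j ∧ n + 1 = (r + 1) * j) ↔ n % (r + 1) = r := by
    constructor
    · rintro ⟨j, hj, hnj⟩
      obtain ⟨i, rfl⟩ := Nat.exists_eq_add_of_le' hj
      rw [show n = r + (r + 1) * i by rw [mul_add] at hnj; omega, Nat.add_mul_mod_self_left,
        Nat.mod_eq_of_lt (Nat.lt_succ_self r)]
    · intro hn
      refine ⟨n / (r + 1) + 1, Nat.succ_pos _, ?_⟩
      have := Nat.mod_add_div n (r + 1)
      rw [mul_add]
      omega
  classical
  unfold posMultiplesIndicator
  rw [Set.indicator_apply]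
  exact if_congr h rfl rfl

theorem mainTheorem5 (k n r : ℕ) (hn : 0 < n) (hk : 4 ≤ k) (hkr : k ≤ r) :
    Hypergraph.turanNumber r n (Hypergraph.bergePaths k) =
      n / (r + 1) * (k - 1) + posMultiplesIndicator (r + 1) (n + 1) := by
  rw [posMultiplesIndicator_succ_succ]
  exact (Hypergraph.isGreatest_bergePathBound (by omega) hkr).csSup_eq
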